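/- A convex body in $\mathbf{R}^n$ is a closed convex set with nonempty interior (possibly unbounded, possibly all of $\mathbf{R}^n$). A convex body $K$ is called - strictly convex if for every $p\in\partial K$ there is a support hyperplane $H$ of $K$ with $K\cap H=\{p\}$; - $C^k$, for $1\le k\le\infty$ or $k=\omega$ (real analytic), if $\partial K$ is an embedded $C^k$ hypersurface, i.e. near each $p\in\partial K$ it is the zero set of a $C^k$ function whose differential at $p$ is nonzero; - positively curved if it is $C^2$ and the differential of its Gauss map (outward unit normal) $\nu\colon\partial K\to\mathbf{S}^{n-1}$ is nonsingular at every point of $\partial K$. (All three conditions hold vacuously if $\partial K=\emptyset$.) **Proposition 5.1.** Let $K_0,K_1\subset\mathbf{R}^n$ be convex bodies, and suppose that their Minkowski sum $K:=K_0+K_1=\{a+b : a\in K_0,\ b\in K_1\}$ is closed. Then $K$ is also a convex body, and the following hold: 1. If $K_0$ and $K_1$ are strictly convex, then so is $K$. 2. If $K_0$ is $C^1$, then so is $K$. 3. For every $2\le k\le\infty$: if $K_0$ and $K_1$ are $C^k$ and $K_0$ is positively curved, then $K$ is also $C^k$. 4. If $K_0$ and $K_1$ are $C^\omega$ and $K_0$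 is positively curved, then $K$ is also $C^\omega$. 5. If $K_0$ and $K_1$ are positively curved, then so is $K$. -/

import Mathlib

open scoped Pointwise ContDiff InnerProductSpace

namespace MinkowskiSum

variable {n : ℕ}

/-- A convex body in `ℝⁿ`: a closed convex set with interior points. It may be unbounded,
and `ℝⁿ` itself is allowed. (Mathlib's `ConvexBody` is compact.) -/
structure IsConvexBody (K : Set (EuclideanSpace ℝ (Fin n))) : Prop where
  convex : Convex ℝ K
  isClosed : IsClosed K
  nonempty_interior : (interior K).Nonempty

/-- `u` is an outward unit normal of `K` at `p ∈ K`: the hyperplane through `p` orthogonal to the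
unit vector `u` supports `K`, and `K` lies in the half-space which `u` points out of. -/
def IsOutwardUnitNormal (K : Set (EuclideanSpace ℝ (Fin n)))
    (p u : EuclideanSpace ℝ (Fin n)) : Prop :=
  p ∈ K ∧ ‖u‖ = 1 ∧ ∀ x ∈ K, ⟪u, x⟫_ℝ ≤ ⟪u, p⟫_ℝ

/-- `p` is a strictly convex point of `K`: some support hyperplane of `K` meets `K` in `p` only. -/
def IsStrictlyConvexPoint (K : Set (EuclideanSpace ℝ (Fin n)))
    (p : EuclideanSpace ℝ (Fin n)) : Prop :=
  ∃ u, IsOutwardUnitNormal K p u ∧ K ∩ {x | ⟪u, x⟫_ℝ = ⟪u, p⟫_ℝ} = {p}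

/-- `K` is strictly convex: every boundary point is a strictly convex point. -/
def IsStrictlyConvex (K : Set (EuclideanSpace ℝ (Fin n))) : Prop :=
  ∀ p ∈ frontier K, IsStrictlyConvexPoint K p

/-- `K` is of class `C^k` (`1 ≤ k ≤ ∞` or `k = ω`): its boundary is an embedded hypersurface of
class `C^k`, that is, near each of its points it is the zero set of a `C^k` function whose
differential does not vanish at that point. -/
def IsOfClass (k : WithTop ℕ∞) (K : Set (EuclideanSpace ℝ (Fin n))) : Prop :=
  ∀ p ∈ frontier K, ∃ (U : Set (EuclideanSpace ℝ (Fin n))) (φ : EuclideanSpace ℝ (Fin n) → ℝ),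
    IsOpen U ∧ p ∈ U ∧ ContDiffOn ℝ k φ U ∧ fderiv ℝ φ p ≠ 0 ∧
      frontier K ∩ U = {x ∈ U | φ x = 0}

/-- `ν` is the Gauss map of `K`: its value at each boundary point is an outward unit normal.
The values of `ν` off the boundary are irrelevant, and on the boundary of a `C^1` convex body they
are determined by this condition. -/
def IsGaussMap (K : Set (EuclideanSpace ℝ (Fin n)))
    (ν : EuclideanSpace ℝ (Fin n) → EuclideanSpace ℝ (Fin n)) : Prop :=
  ∀ p ∈ frontier K, IsOutwardUnitNormal K p (ν p)

/-- `K` has positive curvature: it is `C^2`, and the differential of its Gauss map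
`ν : ∂K → S^{n-1}` is nonsingular at every boundary point `p`. Here the differential of `ν` at `p`
is the restriction to the tangent space `T_p ∂K = (ν p)ᗮ` of a Fréchet derivative `D` of `ν`
within the boundary `∂K`; this restriction does not depend on the choice of `D`. -/
def IsPositivelyCurved (K : Set (EuclideanSpace ℝ (Fin n))) : Prop :=
  IsOfClass 2 K ∧
    ∃ ν : EuclideanSpace ℝ (Fin n) → EuclideanSpace ℝ (Fin n), IsGaussMap K ν ∧
      ∀ p ∈ frontier K, ∃ D : EuclideanSpace ℝ (Fin n) →L[ℝ] EuclideanSpace ℝ (Fin n),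
        HasFDerivWithinAt ν D (frontier K) p ∧ ∀ v, ⟪v, ν p⟫_ℝ = 0 → D v = 0 → v = 0

end MinkowskiSum

/-!
# Convexity and regularity of Minkowski sums

Let `p = a + b` be a boundary point of `K = K₀ + K₁` with outward unit normal `u`. Maximizing `⟪u,
·⟫` over a sum means maximizing it over both summands, so `u` is a normal of `K₀` at `a` and of `K₁`
at `b`, and conversely boundary points of the summands with a common normal add up to a boundary
point of `K`.

*Strict convexity.* The face of `K` with normal `u` is the sum of the faces of `K₀` and `K₁` with
normal `u`, and the faces of a strictly convex body are points.

*Class `C^1`.* A body of class `C^1` has a unique normal at each boundary point. This property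
passes from `K₀` to `K`, because the normals of `K` at `p` are normals of `K₀` at `a`. Conversely,
it implies class `C^1` (`isOfClass_one_of_unique_normal`): unique normals are continuous by
compactness, and this makes the gauge with respect to an interior point continuously differentiable.

*Higher regularity.* Over the hyperplane `uᗮ` the boundaries of `K₀` near `a` and of `K₁` near `b`
are graphs of functions `f` and `g` (`IsOfClass.exists_isBoundaryGraph`), and the boundary of `K`
near `p` is the graph of their infimal convolution `h v = f (v - y) + g y`, where `y` solves `∇f (v
- y) = ∇g y` (`IsBoundaryGraph.exists_add`). Positive curvature of `K₀` means that the Hessian `A`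
of `f` is positive definite. The Hessian `B` of `g` is positive semidefinite, so `A + B` is
invertible and the implicit function theorem gives a solution `y` one degree less regular than `f`
and `g`. The lost degree is regained from `∇h v = ∇f (v - y)`. Finally, a vector `w` in the kernel
of the Hessian of `h` splits as `w = w₀ + w₁` with `A w₀ = B w₁ = 0`, so `h` has a nonsingular
Hessian if `f` and `g` have (`exists_infConvolution`). The Hessian of `f` is the differential of the
Gauss map of `K₀` at `a` (`IsBoundaryGraph.hasFDerivWithinAt_gaussMap`), and likewise for the other
two.
-/

namespace MinkowskiSum

open Filter Topology

variable {n : ℕ}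

/-! ### Supporting hyperplanes -/

section Support

local notation "E" => EuclideanSpace ℝ (Fin n)

theorem inner_lt_of_mem_interior {K : Set E} {p w x : E} (hw : w ≠ 0)
    (h : ∀ y ∈ K, ⟪w, y⟫_ℝ ≤ ⟪w, p⟫_ℝ) (hx : x ∈ interior K) : ⟪w, x⟫_ℝ < ⟪w, p⟫_ℝ := by
  have hc : ContinuousAt (fun t : ℝ => x + t • w) 0 := by fun_prop
  have hev : ∀ᶠ t : ℝ in 𝓝 0, x + t • w ∈ K := by
    apply hc.eventually_mem
    simpa using mem_interior_iff_mem_nhds.mp hx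
  obtain ⟨t, ht, ht0⟩ := ((hev.filter_mono nhdsWithin_le_nhds).and
    (self_mem_nhdsWithin : Set.Ioi (0 : ℝ) ∈ 𝓝[>] (0 : ℝ))).exists
  have h1 := h _ ht
  rw [inner_add_right, inner_smul_right] at h1
  have h2 : 0 < t * ⟪w, w⟫_ℝ := mul_pos ht0 (real_inner_self_pos.mpr hw)
  linarith

theorem mem_frontier_of_support {K : Set E} {p w : E} (hp : p ∈ K) (hw : w ≠ 0)
    (h : ∀ y ∈ K, ⟪w, y⟫_ℝ ≤ ⟪w, p⟫_ℝ) : p ∈ frontier K :=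
  ⟨subset_closure hp, fun hi => (inner_lt_of_mem_interior hw h hi).false⟩

namespace IsOutwardUnitNormal

theorem ne_zero {K : Set E} {p u : E} (h : IsOutwardUnitNormal K p u) : u ≠ 0 := by
  rintro rfl
  simpa using h.2.1

theorem mem_frontier {K : Set E} {p u : E} (h : IsOutwardUnitNormal K p u) : p ∈ frontier K :=
  mem_frontier_of_support h.1 h.ne_zero h.2.2

theorem left_of_add {K₀ K₁ : Set E} {a b u : E} (ha : a ∈ K₀) (hb : b ∈ K₁)
    (h : IsOutwardUnitNormal (K₀ + K₁) (a + b) u) : IsOutwardUnitNormal K₀ a u := by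
  refine ⟨ha, h.2.1, fun x hx => ?_⟩
  have := h.2.2 _ (Set.add_mem_add hx hb)
  rw [inner_add_right, inner_add_right] at this
  linarith

theorem right_of_add {K₀ K₁ : Set E} {a b u : E} (ha : a ∈ K₀) (hb : b ∈ K₁)
    (h : IsOutwardUnitNormal (K₀ + K₁) (a + b) u) : IsOutwardUnitNormal K₁ b u := by
  rw [add_comm K₀, add_comm a] at h
  exact h.left_of_add hb ha

end IsOutwardUnitNormal

namespace IsConvexBody

theorem exists_normal {K : Set E} (hK : IsConvexBody K) {p : E} (hp : p ∈ frontier K) :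
    ∃ u, IsOutwardUnitNormal K p u := by
  obtain ⟨f, hf, hle⟩ :=
    geometric_hahn_banach_of_nonempty_interior_point hK.convex hp.2 hK.nonempty_interior
  set w := (InnerProductSpace.toDual ℝ E).symm f with hw
  have hfw : ∀ x, f x = ⟪w, x⟫_ℝ := fun x => by simp [hw]
  have hw0 : w ≠ 0 := by simpa [hw] using hf
  refine ⟨‖w‖⁻¹ • w, hK.isClosed.frontier_subset hp, ?_, fun x hx => ?_⟩
  · rw [norm_smul, norm_inv, norm_norm, inv_mul_cancel₀ (norm_ne_zero_iff.mpr hw0)]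
  · rw [real_inner_smul_left, real_inner_smul_left, ← hfw, ← hfw]
    exact mul_le_mul_of_nonneg_left (hle x hx) (by positivity)

end IsConvexBody

theorem add_mem_interior_add {K₀ K₁ : Set E} {a b : E} (ha : a ∈ interior K₀) (hb : b ∈ K₁) :
    a + b ∈ interior (K₀ + K₁) := by
  have h : interior K₀ + K₁ ⊆ interior (K₀ + K₁) :=
    interior_maximal (Set.add_subset_add_right interior_subset) isOpen_interior.add_right
  exact h (Set.add_mem_add ha hb)

theorem IsConvexBody.add {K₀ K₁ : Set E} (h₀ : IsConvexBody K₀) (h₁ : IsConvexBody K₁)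
    (hc : IsClosed (K₀ + K₁)) : IsConvexBody (K₀ + K₁) := by
  obtain ⟨a, ha⟩ := h₀.nonempty_interior
  obtain ⟨b, hb⟩ := h₁.nonempty_interior
  exact ⟨h₀.convex.add h₁.convex, hc, _, add_mem_interior_add ha (interior_subset hb)⟩

/-! ### Strict convexity -/

/-- The midpoint of two points of one face is a boundary point, and each hyperplane which supports
`K` at this midpoint contains both points. -/
theorem IsStrictlyConvex.eq_of_inner_eq {K : Set E} (hK : Convex ℝ K) (hs : IsStrictlyConvex K)
    {a u x : E} (hu : IsOutwardUnitNormal K a u) (hx : x ∈ K)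
    (hxa : ⟪u, x⟫_ℝ = ⟪u, a⟫_ℝ) : x = a := by
  set m : E := (2⁻¹ : ℝ) • x + (2⁻¹ : ℝ) • a with hm
  have hmK : m ∈ K := hK hx hu.1 (by norm_num) (by norm_num) (by norm_num)
  have hum : ⟪u, m⟫_ℝ = ⟪u, a⟫_ℝ := by
    rw [hm, inner_add_right, inner_smul_right, inner_smul_right, hxa]; ring
  have hmF : m ∈ frontier K :=
    mem_frontier_of_support hmK hu.ne_zero fun y hy => hum ▸ hu.2.2 y hy
  obtain ⟨w, hw, hwm⟩ := hs m hmF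
  have hwx := hw.2.2 x hx
  have hwa := hw.2.2 a hu.1
  have hwm' : ⟪w, m⟫_ℝ = 2⁻¹ * ⟪w, x⟫_ℝ + 2⁻¹ * ⟪w, a⟫_ℝ := by
    rw [hm, inner_add_right, inner_smul_right, inner_smul_right]
  have h1 : x ∈ K ∩ {y | ⟪w, y⟫_ℝ = ⟪w, m⟫_ℝ} :=
    ⟨hx, show ⟪w, x⟫_ℝ = ⟪w, m⟫_ℝ by linarith⟩
  have h2 : a ∈ K ∩ {y | ⟪w, y⟫_ℝ = ⟪w, m⟫_ℝ} :=
    ⟨hu.1, show ⟪w, a⟫_ℝ = ⟪w, m⟫_ℝ by linarith⟩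
  rw [hwm] at h1 h2
  exact h1.trans h2.symm

theorem IsStrictlyConvex.add {K₀ K₁ : Set E} (h₀ : IsConvexBody K₀) (h₁ : IsConvexBody K₁)
    (hc : IsClosed (K₀ + K₁)) (s₀ : IsStrictlyConvex K₀) (s₁ : IsStrictlyConvex K₁) :
    IsStrictlyConvex (K₀ + K₁) := by
  intro p hp
  obtain ⟨u, hu⟩ := (h₀.add h₁ hc).exists_normal hp
  refine ⟨u, hu, Set.Subset.antisymm ?_ (by simpa using hu.1)⟩
  obtain ⟨a, ha, b, hb, rfl⟩ := Set.mem_add.mp hu.1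
  have hua := hu.left_of_add ha hb
  have hub := hu.right_of_add ha hb
  rintro x ⟨hx, hxu⟩
  obtain ⟨a', ha', b', hb', rfl⟩ := Set.mem_add.mp hx
  have h1 := hua.2.2 a' ha'
  have h2 := hub.2.2 b' hb'
  have h3 : ⟪u, a' + b'⟫_ℝ = ⟪u, a + b⟫_ℝ := hxu
  rw [inner_add_right, inner_add_right] at h3
  rw [s₀.eq_of_inner_eq h₀.convex hua ha' (by linarith),
    s₁.eq_of_inner_eq h₁.convex hub hb' (by linarith)]
  rfl

end Support

/-! ### Implicit functions and infimal convolution -/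

section Analysis

variable {X Y Z : Type*} [NormedAddCommGroup X] [NormedSpace ℝ X] [CompleteSpace X]
  [NormedAddCommGroup Y] [NormedSpace ℝ Y] [CompleteSpace Y]
  [NormedAddCommGroup Z] [NormedSpace ℝ Z] [CompleteSpace Z]

/-- The implicit function theorem, with the regularity of the implicit function on a neighbourhood.
For `k = ∞` this is more than regularity at the base point. -/
theorem exists_implicit_contDiffAt {k : ℕ∞ω} (hk : k ≠ 0) {f : X × Y → Z} {x₀ : X} {y₀ : Y}
    (hf : ∀ᶠ z in 𝓝 (x₀, y₀), ContDiffAt ℝ k f z)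
    (hinv : (fderiv ℝ f (x₀, y₀) ∘L .inr ℝ X Y).IsInvertible) :
    ∃ η : X → Y, η x₀ = y₀ ∧ ∀ᶠ x in 𝓝 x₀, f (x, η x) = f (x₀, y₀) ∧ ContDiffAt ℝ k η x := by
  have cdf := hf.self_of_nhds
  set η := cdf.implicitFunction hk hinv with hη
  have h0 : η x₀ = y₀ := cdf.implicitFunction_apply_self hk hinv
  have hcd : ContDiffAt ℝ k η x₀ := cdf.contDiffAt_implicitFunction hk hinv
  have hcont : ∀ᶠ x in 𝓝 x₀, ContinuousAt η x := by
    have h1 : ContDiffAt ℝ 1 η x₀ := hcd.of_le (ENat.one_le_iff_ne_zero_withTop.mpr hk)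
    filter_upwards [h1.eventually (by simp)] with x hx using hx.continuousAt
  have hiff := cdf.eventually_apply_eq_iff_implicitFunction hk hinv
  have hinv' : ∀ᶠ z in 𝓝 (x₀, y₀), (fderiv ℝ f z ∘L .inr ℝ X Y).IsInvertible := by
    have h1 : ContDiffAt ℝ 1 f (x₀, y₀) := cdf.of_le (ENat.one_le_iff_ne_zero_withTop.mpr hk)
    have hc : ContinuousAt (fun z => fderiv ℝ f z ∘L .inr ℝ X Y) (x₀, y₀) :=
      ((h1.fderiv_right (m := 0) (by simp)).continuousAt).clm_comp continuousAt_const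
    obtain ⟨e, he⟩ := hinv
    have := hc.eventually_mem (s := Set.range ((↑) : (Y ≃L[ℝ] Z) → Y →L[ℝ] Z))
      (by rw [← he]; exact ContinuousLinearEquiv.nhds e)
    exact this
  have hpair : Tendsto (fun x => (x, η x)) (𝓝 x₀) (𝓝 (x₀, y₀)) := by
    have : ContinuousAt (fun x => (x, η x)) x₀ := continuousAt_id.prodMk hcd.continuousAt
    simpa [ContinuousAt, h0] using this
  refine ⟨η, h0, ?_⟩
  filter_upwards [hcont, hpair.eventually hf, hpair.eventually hinv',
    hpair.eventually hiff.eventually_nhds] with x hx hfx hix hiffx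
  have hfx0 : f (x, η x) = f (x₀, y₀) := hiffx.self_of_nhds.mpr rfl
  refine ⟨hfx0, ?_⟩
  -- Near `x`, the function `η` agrees with the implicit function based at `(x, η x)`.
  set ψ := hfx.implicitFunction hk hix with hψ
  have hψ0 : ψ x = η x := hfx.implicitFunction_apply_self hk hix
  have hψc : ContDiffAt ℝ k ψ x := hfx.contDiffAt_implicitFunction hk hix
  refine hψc.congr_of_eventuallyEq ?_
  have hpair' : Tendsto (fun x' => (x', ψ x')) (𝓝 x) (𝓝 (x, η x)) := by
    have : ContinuousAt (fun x => (x, ψ x)) x := continuousAt_id.prodMk hψc.continuousAt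
    simpa [ContinuousAt, hψ0] using this
  filter_upwards [hpair'.eventually hiffx, hfx.eventually_apply_implicitFunction hk hix]
    with x' h1 h2
  exact h1.mp (h2.trans hfx0)

end Analysis

section Gradient

variable {V : Type*} [NormedAddCommGroup V] [InnerProductSpace ℝ V]

/-- A zero of the quadratic form of a symmetric positive semidefinite operator lies in its
kernel. -/
theorem apply_eq_zero_of_inner_self_eq_zero {A : V →L[ℝ] V}
    (hsymm : ∀ x y, ⟪A x, y⟫_ℝ = ⟪x, A y⟫_ℝ) (hpos : ∀ x, 0 ≤ ⟪A x, x⟫_ℝ) {w : V}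
    (hw : ⟪A w, w⟫_ℝ = 0) : A w = 0 := by
  -- The quadratic form is nonnegative along the line `w + t • A w`.
  have h : ∀ t : ℝ, 0 ≤ ⟪A (A w), A w⟫_ℝ * (t * t) + 2 * ⟪A w, A w⟫_ℝ * t + 0 := by
    intro t
    have h1 := hpos (w + t • A w)
    rw [map_add, map_smul, inner_add_left, inner_add_right, inner_add_right,
      real_inner_smul_left, real_inner_smul_left, real_inner_smul_right, real_inner_smul_right,
      hw, hsymm (A w) w] at h1
    linarith
  have hd := discrim_le_zero h
  rw [discrim] at hd
  have : ⟪A w, A w⟫_ℝ = 0 := by nlinarith [sq_nonneg ⟪A w, A w⟫_ℝ]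
  exact inner_self_eq_zero.mp this

variable [CompleteSpace V]

theorem contDiffAt_gradient {k m : ℕ∞ω} (hmk : m + 1 ≤ k) {f : V → ℝ} {v : V}
    (hf : ContDiffAt ℝ k f v) : ContDiffAt ℝ m (gradient f) v :=
  ((InnerProductSpace.toDual ℝ V).symm.contDiff).contDiffAt.comp v (hf.fderiv_right hmk)

/-- A function of class `C^m` whose gradient is of class `C^m` is of class `C^(m+1)`. -/
theorem contDiffAt_of_hasGradientAt {k m : ℕ∞ω} (hkm : k ≤ m + 1) {h : V → ℝ} {F : V → V} {v : V}
    (hh : ContDiffAt ℝ m h v) (hgrad : ∀ᶠ w in 𝓝 v, HasGradientAt h (F w) w)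
    (hF : ContDiffAt ℝ m F v) : ContDiffAt ℝ k h v := by
  refine ContDiffAt.of_le ?_ hkm
  match m with
  | ω => simpa using hh
  | (⊤ : ℕ∞) => simpa using hh
  | (m : ℕ) =>
    refine contDiffAt_succ_iff_hasFDerivAt.mpr
      ⟨fun w => InnerProductSpace.toDual ℝ V (F w), ⟨_, hgrad, fun w hw => hw⟩, ?_⟩
    exact ((InnerProductSpace.toDual ℝ V).contDiff).contDiffAt.comp v hF

theorem inner_fderiv_gradient_comm {f : V → ℝ} {v : V} (hf : ContDiffAt ℝ 2 f v) (x y : V) :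
    ⟪fderiv ℝ (gradient f) v x, y⟫_ℝ = ⟪x, fderiv ℝ (gradient f) v y⟫_ℝ := by
  have hd : DifferentiableAt ℝ (fderiv ℝ f) v :=
    (hf.fderiv_right (m := 1) (by norm_num)).differentiableAt (by simp)
  have hg : DifferentiableAt ℝ (gradient f) v :=
    (contDiffAt_gradient (m := 1) (by norm_num) hf).differentiableAt (by simp)
  have key : ∀ a b, ⟪fderiv ℝ (gradient f) v a, b⟫_ℝ = fderiv ℝ (fderiv ℝ f) v a b := by
    intro a b
    have h1 : HasFDerivAt (fun w => ⟪gradient f w, b⟫_ℝ)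
        ((fderivInnerCLM ℝ (gradient f v, b)).comp ((fderiv ℝ (gradient f) v).prod 0)) v :=
      hg.hasFDerivAt.inner ℝ (hasFDerivAt_const b v)
    have h2 : HasFDerivAt (fun w => fderiv ℝ f w b) ((fderiv ℝ (fderiv ℝ f) v).flip b) v := by
      simpa using hd.hasFDerivAt.clm_apply (hasFDerivAt_const b v)
    have h3 : (fun w => ⟪gradient f w, b⟫_ℝ) = fun w => fderiv ℝ f w b :=
      funext fun w => inner_gradient_left
    rw [h3] at h1
    simpa using DFunLike.congr_fun (h1.unique h2) a
  rw [real_inner_comm _ x, key, key, (hf.isSymmSndFDerivAt (by simp)).eq]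

/-- The infimal convolution `h` of two functions with common critical point `0`, one of which has
a positive definite Hessian there, and the other one a positive semidefinite Hessian. For `v` near
`0` the equation `∇f (v - η v) = ∇g (η v)` of the optimal splitting of `v` has a solution `η` of
class `C^m`, and `h v = f (v - η v) + g (η v)` has the gradient `∇f (v - η v)`, which makes `h` one
degree more regular than `η`. The Hessian of `h` is the parallel sum of those of `f` and `g`. -/
theorem exists_infConvolution [FiniteDimensional ℝ V] {k m : ℕ∞ω} (hm : m ≠ 0) (hkm : k = m + 1)
    {f g : V → ℝ} (hf : ∀ᶠ v in 𝓝 0, ContDiffAt ℝ k f v) (hg : ∀ᶠ v in 𝓝 0, ContDiffAt ℝ k g v)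
    (hf0 : gradient f 0 = 0) (hg0 : gradient g 0 = 0)
    (hfpos : ∀ w, 0 ≤ ⟪fderiv ℝ (gradient f) 0 w, w⟫_ℝ)
    (hgpos : ∀ w, 0 ≤ ⟪fderiv ℝ (gradient g) 0 w, w⟫_ℝ)
    (hinj : ∀ w, fderiv ℝ (gradient f) 0 w = 0 → w = 0) :
    ∃ η : V → V, η 0 = 0 ∧ ContinuousAt η 0 ∧
      (∀ᶠ v in 𝓝 0, gradient f (v - η v) = gradient g (η v)) ∧
      (∀ᶠ v in 𝓝 0, ContDiffAt ℝ k (fun v => f (v - η v) + g (η v)) v) ∧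
      ((∀ w, fderiv ℝ (gradient g) 0 w = 0 → w = 0) →
        ∀ w, fderiv ℝ (gradient fun v => f (v - η v) + g (η v)) 0 w = 0 → w = 0) := by
  have hm1 : 1 ≤ m := ENat.one_le_iff_ne_zero_withTop.mpr hm
  have hk2 : 2 ≤ k := by
    rw [hkm]; exact (by norm_num : (2 : ℕ∞ω) = 1 + 1).trans_le (by gcongr)
  have hk0 : k ≠ 0 := by rintro rfl; simp at hk2
  have hmk : m + 1 ≤ k := hkm.ge
  set A := fderiv ℝ (gradient f) 0 with hA
  set B := fderiv ℝ (gradient g) 0 with hB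
  have hfg : ∀ᶠ v in 𝓝 0, ContDiffAt ℝ m (gradient f) v :=
    hf.mono fun v hv => contDiffAt_gradient hmk hv
  have hgg : ∀ᶠ v in 𝓝 0, ContDiffAt ℝ m (gradient g) v :=
    hg.mono fun v hv => contDiffAt_gradient hmk hv
  have hfA : HasFDerivAt (gradient f) A 0 :=
    (hfg.self_of_nhds.differentiableAt hm).hasFDerivAt
  have hgB : HasFDerivAt (gradient g) B 0 :=
    (hgg.self_of_nhds.differentiableAt hm).hasFDerivAt
  have hsymm := inner_fderiv_gradient_comm (hf.self_of_nhds.of_le hk2)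
  -- The equation of the optimal splitting can be solved by the implicit function theorem.
  set Θ : V × V → V := fun z => gradient f (z.1 - z.2) - gradient g z.2 with hΘ
  have hΘk : ∀ᶠ z in 𝓝 ((0 : V), (0 : V)), ContDiffAt ℝ m Θ z := by
    have t1 : Tendsto (fun z : V × V => z.1 - z.2) (𝓝 (0, 0)) (𝓝 0) :=
      (continuous_fst.sub continuous_snd).tendsto' _ _ (by simp)
    have t2 : Tendsto (fun z : V × V => z.2) (𝓝 (0, 0)) (𝓝 0) :=
      continuous_snd.tendsto' _ _ rfl
    filter_upwards [t1.eventually hfg, t2.eventually hgg] with z h1 h2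
    exact (ContDiffAt.comp z h1 (contDiffAt_fst.sub contDiffAt_snd)).sub
      (ContDiffAt.comp z h2 contDiffAt_snd)
  have hΘ' : HasFDerivAt Θ (A ∘L (.fst ℝ V V - .snd ℝ V V) - B ∘L .snd ℝ V V)
      ((0 : V), (0 : V)) := by
    have h1 : HasFDerivAt (fun z : V × V => z.1 - z.2) (.fst ℝ V V - .snd ℝ V V)
        ((0 : V), (0 : V)) :=
      hasFDerivAt_fst.sub hasFDerivAt_snd
    have h2 : HasFDerivAt (fun z : V × V => z.2) (.snd ℝ V V) ((0 : V), (0 : V)) := hasFDerivAt_snd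
    exact (HasFDerivAt.comp _ (by simpa using hfA) h1).sub
      (HasFDerivAt.comp _ (by simpa using hgB) h2)
  have hinv : (fderiv ℝ Θ ((0 : V), (0 : V)) ∘L .inr ℝ V V).IsInvertible := by
    set L := fderiv ℝ Θ ((0 : V), (0 : V)) ∘L .inr ℝ V V with hL
    have hLw : ∀ w, L w = -(A w + B w) := fun w => by
      rw [hL, hΘ'.fderiv]; simp; abel
    have hLinj : Function.Injective L := by
      rw [injective_iff_map_eq_zero]
      intro w hw
      rw [hLw, neg_eq_zero] at hw
      have h1 : ⟪A w, w⟫_ℝ + ⟪B w, w⟫_ℝ = 0 := by rw [← inner_add_left, hw, inner_zero_left]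
      exact hinj w (apply_eq_zero_of_inner_self_eq_zero hsymm hfpos
        (by linarith [hfpos w, hgpos w]))
    exact ⟨(LinearEquiv.ofInjectiveEndo (L : V →ₗ[ℝ] V) hLinj).toContinuousLinearEquiv, by ext; rfl⟩
  obtain ⟨η, hη0, hη⟩ := exists_implicit_contDiffAt hm hΘk hinv
  have hηc : ContinuousAt η 0 := hη.self_of_nhds.2.continuousAt
  have hyt : Tendsto η (𝓝 0) (𝓝 0) := by simpa [ContinuousAt, hη0] using hηc
  have hxt : Tendsto (fun v => v - η v) (𝓝 0) (𝓝 0) := by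
    simpa using (tendsto_id (α := V) (x := 𝓝 0)).sub hyt
  have heq : ∀ᶠ v in 𝓝 0, gradient f (v - η v) = gradient g (η v) := by
    filter_upwards [hη] with v hv
    have := hv.1
    simp only [hΘ, sub_self, hf0, hg0] at this
    exact sub_eq_zero.mp this
  have hgrad : ∀ᶠ v in 𝓝 0, HasGradientAt (fun v => f (v - η v) + g (η v))
      (gradient f (v - η v)) v := by
    filter_upwards [heq, hη, hxt.eventually hf, hyt.eventually hg] with v h1 h2 h3 h4
    have hηv : HasFDerivAt η (fderiv ℝ η v) v := (h2.2.differentiableAt hm).hasFDerivAt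
    have d1 := HasFDerivAt.comp v (h3.differentiableAt hk0).hasGradientAt.hasFDerivAt
      ((hasFDerivAt_id v).sub hηv)
    have d2 := HasFDerivAt.comp v (h4.differentiableAt hk0).hasGradientAt.hasFDerivAt hηv
    refine (d1.add d2).congr_fderiv ?_
    ext w
    simp [h1]
  have hηf : ∀ᶠ v in 𝓝 0, ContDiffAt ℝ m (fun v => gradient f (v - η v)) v := by
    filter_upwards [hη, hxt.eventually hfg] with v h2 h3
    exact ContDiffAt.comp (g := gradient f) v h3 (contDiffAt_id.sub h2.2)
  refine ⟨η, hη0, hηc, heq, ?_, fun hginj w hw => ?_⟩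
  · filter_upwards [hη, hgrad.eventually_nhds, hηf, hxt.eventually hf, hyt.eventually hg]
      with v h2 h3 h4 h5 h6
    refine contDiffAt_of_hasGradientAt hkm.le ?_ h3 h4
    exact (ContDiffAt.comp v (h5.of_le (le_self_add.trans hmk)) (contDiffAt_id.sub h2.2)).add
      (ContDiffAt.comp v (h6.of_le (le_self_add.trans hmk)) h2.2)
  · have hη' : HasFDerivAt η (fderiv ℝ η 0) 0 :=
      (hη.self_of_nhds.2.differentiableAt hm).hasFDerivAt
    have e1 : (gradient fun v => f (v - η v) + g (η v)) =ᶠ[𝓝 0] fun v => gradient f (v - η v) :=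
      hgrad.mono fun v hv => hv.gradient
    have d1 : HasFDerivAt (fun v => gradient f (v - η v)) (A ∘L (.id ℝ V - fderiv ℝ η 0)) 0 :=
      HasFDerivAt.comp (g := gradient f) (0 : V) (by simpa [hη0] using hfA)
        ((hasFDerivAt_id (0 : V)).sub hη')
    have d2 : HasFDerivAt (fun v => gradient g (η v)) (B ∘L fderiv ℝ η 0) 0 :=
      HasFDerivAt.comp (g := gradient g) (0 : V) (by simpa [hη0] using hgB) hη'
    have hw1 : A (w - fderiv ℝ η 0 w) = 0 := by
      rw [e1.fderiv_eq, d1.fderiv] at hw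
      simpa using hw
    have hw2 : B (fderiv ℝ η 0 w) = 0 := by
      rw [e1.fderiv_eq, EventuallyEq.fderiv_eq heq, d2.fderiv] at hw
      simpa using hw
    have := hinj _ hw1
    rwa [hginj _ hw2, sub_zero] at this

end Gradient

/-! ### The boundary as a graph over a tangent hyperplane -/

section Graph

local notation "E" => EuclideanSpace ℝ (Fin n)

/-- The point over `v` of the graph of `f`, in the coordinates with origin `p` whose horizontal
hyperplane is the orthogonal complement of `u` and whose vertical direction is `-u`. With an outward
normal `u` of a convex body at `p`, the body lies above its boundary. -/
def graphMap (p u : E) (f : (ℝ ∙ u)ᗮ → ℝ) (v : (ℝ ∙ u)ᗮ) : E := p + v - f v • u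

/-- `u` is an outward unit normal of `K` at `p`, and near `p` the graph over the hyperplane
`p + uᗮ` of a function `f` of class `C^k` with `f 0 = 0` is contained in the boundary of `K`.
That this graph is the whole boundary near `p` is a consequence if `K` is a convex body, see
`IsBoundaryGraph.eventually_mem_frontier_iff`. -/
structure IsBoundaryGraph (k : ℕ∞ω) (K : Set E) (p u : E) (f : (ℝ ∙ u)ᗮ → ℝ) : Prop where
  normal : IsOutwardUnitNormal K p u
  zero : f 0 = 0
  contDiffAt : ∀ᶠ v in 𝓝 0, ContDiffAt ℝ k f v
  mem_frontier : ∀ᶠ v in 𝓝 0, graphMap p u f v ∈ frontier K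

/-- The outward normal `u + ∇f` of the epigraph of `f`, not normalized, at its boundary point
`graphMap p u f v`. -/
noncomputable def graphNormal (u : E) (f : (ℝ ∙ u)ᗮ → ℝ) (v : (ℝ ∙ u)ᗮ) : E :=
  u + (gradient f v : (ℝ ∙ u)ᗮ)

theorem exists_eq_add_smul (u x : E) : ∃ (v : (ℝ ∙ u)ᗮ) (s : ℝ), x = v + s • u := by
  obtain ⟨y, hy, z, hz, rfl⟩ := (ℝ ∙ u).exists_add_mem_mem_orthogonal x
  obtain ⟨s, rfl⟩ := Submodule.mem_span_singleton.mp hy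
  exact ⟨⟨z, hz⟩, s, add_comm _ _⟩

theorem inner_coe_orthogonal {u : E} (v : (ℝ ∙ u)ᗮ) : ⟪u, (v : E)⟫_ℝ = 0 :=
  Submodule.mem_orthogonal_singleton_iff_inner_right.mp v.2

theorem inner_coe_orthogonal' {u : E} (v : (ℝ ∙ u)ᗮ) : ⟪(v : E), u⟫_ℝ = 0 :=
  Submodule.mem_orthogonal_singleton_iff_inner_left.mp v.2

theorem graphMap_zero {p u : E} {f : (ℝ ∙ u)ᗮ → ℝ} (hf : f 0 = 0) : graphMap p u f 0 = p := by
  simp [graphMap, hf]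

theorem hasFDerivAt_graphMap {p u : E} {f : (ℝ ∙ u)ᗮ → ℝ} {v : (ℝ ∙ u)ᗮ}
    (hf : DifferentiableAt ℝ f v) :
    HasFDerivAt (graphMap p u f) ((ℝ ∙ u)ᗮ.subtypeL - (fderiv ℝ f v).smulRight u) v :=
  (((ℝ ∙ u)ᗮ.subtypeL.hasFDerivAt).const_add p).sub (hf.hasFDerivAt.smul_const u)

/-- A support hyperplane of `K` at a point of a graph contained in `K` is tangent to this graph. -/
theorem inner_eq_of_support_graphMap {K : Set E} {p u w : E} {f : (ℝ ∙ u)ᗮ → ℝ} {v : (ℝ ∙ u)ᗮ}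
    (hf : DifferentiableAt ℝ f v) (hmem : ∀ᶠ v' in 𝓝 v, graphMap p u f v' ∈ K)
    (hw : ∀ x ∈ K, ⟪w, x⟫_ℝ ≤ ⟪w, graphMap p u f v⟫_ℝ) (v' : (ℝ ∙ u)ᗮ) :
    ⟪w, (v' : E)⟫_ℝ = ⟪w, u⟫_ℝ * fderiv ℝ f v v' := by
  have hmax : IsLocalMax (fun v' => ⟪w, graphMap p u f v'⟫_ℝ) v := hmem.mono fun v' h => hw _ h
  have hd := ((innerSL ℝ w).hasFDerivAt).comp v (hasFDerivAt_graphMap (p := p) hf)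
  have h0 := DFunLike.congr_fun (hmax.hasFDerivAt_eq_zero hd) v'
  simp only [ContinuousLinearMap.comp_apply, innerSL_apply_apply, sub_apply,
    Submodule.subtypeL_apply, ContinuousLinearMap.smulRight_apply, inner_sub_right,
    real_inner_smul_right, zero_apply] at h0
  linarith

theorem eq_smul_of_support_graphMap {K : Set E} {p u w : E} {f : (ℝ ∙ u)ᗮ → ℝ} {v : (ℝ ∙ u)ᗮ}
    (hu : ‖u‖ = 1) (hf : DifferentiableAt ℝ f v) (hmem : ∀ᶠ v' in 𝓝 v, graphMap p u f v' ∈ K)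
    (hw : ∀ x ∈ K, ⟪w, x⟫_ℝ ≤ ⟪w, graphMap p u f v⟫_ℝ) :
    w = ⟪w, u⟫_ℝ • graphNormal u f v := by
  refine ext_inner_right ℝ fun x => ?_
  obtain ⟨v', s, rfl⟩ := exists_eq_add_smul u x
  have h2 : ⟪((gradient f v : (ℝ ∙ u)ᗮ) : E), (v' : E)⟫_ℝ = fderiv ℝ f v v' := by
    rw [← Submodule.coe_inner, inner_gradient_left]
  rw [inner_add_right, inner_eq_of_support_graphMap hf hmem hw, real_inner_smul_left,
    graphNormal,    inner_add_left, inner_add_right, inner_add_right, inner_coe_orthogonal, h2,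
    real_inner_smul_right, real_inner_smul_right, real_inner_smul_right, inner_coe_orthogonal',
    real_inner_self_eq_norm_sq, hu]
  ring

/-- A level set of a `C^k` function is a `C^k` graph along any direction transverse to it. -/
theorem exists_graphMap_of_fderiv_ne_zero {k : ℕ∞ω} (hk : k ≠ 0) {φ : E → ℝ} {p u : E}
    (hφ : ∀ᶠ x in 𝓝 p, ContDiffAt ℝ k φ x) (hu : fderiv ℝ φ p u ≠ 0) :
    ∃ f : (ℝ ∙ u)ᗮ → ℝ, f 0 = 0 ∧
      ∀ᶠ v in 𝓝 0, φ (graphMap p u f v) = φ p ∧ ContDiffAt ℝ k f v := by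
  set G : (ℝ ∙ u)ᗮ × ℝ → E := fun z => p + z.1 - z.2 • u with hG
  have hG0 : G (0, 0) = p := by simp [hG]
  have hGk : ContDiff ℝ k G :=
    (contDiff_const.add ((ℝ ∙ u)ᗮ.subtypeL.contDiff.comp contDiff_fst)).sub
      (contDiff_snd.smul contDiff_const)
  have hGd : HasFDerivAt G ((ℝ ∙ u)ᗮ.subtypeL ∘L .fst ℝ (ℝ ∙ u)ᗮ ℝ -
      (ContinuousLinearMap.snd ℝ (ℝ ∙ u)ᗮ ℝ).smulRight u) (0, 0) :=
    ((((ℝ ∙ u)ᗮ.subtypeL ∘L .fst ℝ (ℝ ∙ u)ᗮ ℝ).hasFDerivAt).const_add p).sub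
      ((ContinuousLinearMap.snd ℝ (ℝ ∙ u)ᗮ ℝ).hasFDerivAt.smul_const u)
  have hφd : HasFDerivAt φ (fderiv ℝ φ p) (G (0, 0)) := by
    rw [hG0]; exact (hφ.self_of_nhds.differentiableAt hk).hasFDerivAt
  have hd := hφd.comp _ hGd
  have hFk : ∀ᶠ z in 𝓝 ((0 : (ℝ ∙ u)ᗮ), (0 : ℝ)), ContDiffAt ℝ k (φ ∘ G) z := by
    have ht : Tendsto G (𝓝 (0, 0)) (𝓝 p) := hGk.continuous.tendsto' _ _ hG0
    filter_upwards [ht.eventually hφ] with z hz using hz.comp z hGk.contDiffAt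
  have hinv : (fderiv ℝ (φ ∘ G) (0, 0) ∘L .inr ℝ (ℝ ∙ u)ᗮ ℝ).IsInvertible := by
    set L := fderiv ℝ (φ ∘ G) (0, 0) ∘L .inr ℝ (ℝ ∙ u)ᗮ ℝ with hL
    have hLt : ∀ t, L t = -(t * fderiv ℝ φ p u) := fun t => by
      rw [hL, hd.fderiv]; simp
    have hLinj : Function.Injective L := by
      rw [injective_iff_map_eq_zero]
      intro t ht
      rw [hLt, neg_eq_zero] at ht
      exact (mul_eq_zero.mp ht).resolve_right hu
    exact ⟨(LinearEquiv.ofInjectiveEndo (L : ℝ →ₗ[ℝ] ℝ) hLinj).toContinuousLinearEquiv, by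
      ext; rfl⟩
  obtain ⟨f, hf0, hf⟩ := exists_implicit_contDiffAt hk hFk hinv
  refine ⟨f, hf0, hf.mono fun v hv => ⟨?_, hv.2⟩⟩
  have := hv.1
  rwa [Function.comp_apply, Function.comp_apply, hG0] at this

/-- The boundary of a set of class `C^k` is locally a `C^k` graph over any support hyperplane. -/
theorem IsOfClass.exists_isBoundaryGraph {k : ℕ∞ω} (hk : k ≠ 0) {K : Set E} (hc : IsClosed K)
    (h : IsOfClass k K) {p u : E} (hu : IsOutwardUnitNormal K p u) :
    ∃ f, IsBoundaryGraph k K p u f := by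
  obtain ⟨U, φ, hU, hpU, hφ, hφ0, hfr⟩ := h p hu.mem_frontier
  have hφk : ∀ᶠ x in 𝓝 p, ContDiffAt ℝ k φ x := by
    filter_upwards [hU.mem_nhds hpU] with x hx using hφ.contDiffAt (hU.mem_nhds hx)
  have hφp : φ p = 0 := by
    have : p ∈ frontier K ∩ U := ⟨hu.mem_frontier, hpU⟩
    rw [hfr] at this
    exact this.2
  have hmem : ∀ {e : E} {f : (ℝ ∙ e)ᗮ → ℝ}, f 0 = 0 →
      (∀ᶠ v in 𝓝 0, φ (graphMap p e f v) = φ p ∧ ContDiffAt ℝ k f v) →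
      ∀ᶠ v in 𝓝 0, graphMap p e f v ∈ frontier K := by
    intro e f hf0 hf
    have ht : Tendsto (graphMap p e f) (𝓝 0) (𝓝 p) := by
      have := (hasFDerivAt_graphMap (p := p)
        (hf.self_of_nhds.2.differentiableAt hk)).continuousAt
      rwa [ContinuousAt, graphMap_zero hf0] at this
    filter_upwards [hf, ht.eventually (hU.mem_nhds hpU)] with v hv hvU
    have : graphMap p e f v ∈ {x ∈ U | φ x = 0} := ⟨hvU, hv.1.trans hφp⟩
    rw [← hfr] at this
    exact this.1
  -- The normal `u` is transverse to the boundary, because it is orthogonal to the boundary, as a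
  -- graph along some direction `e` transverse to it.
  have hφu : fderiv ℝ φ p u ≠ 0 := by
    obtain ⟨e, he⟩ : ∃ e, fderiv ℝ φ p e ≠ 0 := by
      by_contra! hall
      exact hφ0 (ContinuousLinearMap.ext hall)
    obtain ⟨f, hf0, hf⟩ := exists_graphMap_of_fderiv_ne_zero hk hφk he
    have hfd := hf.self_of_nhds.2.differentiableAt hk
    have h1 := inner_eq_of_support_graphMap (w := u) hfd
      ((hmem hf0 hf).mono fun v hv => hc.frontier_subset hv)
      (by rw [graphMap_zero hf0]; exact hu.2.2)
    have h2 : ∀ v' : (ℝ ∙ e)ᗮ, fderiv ℝ φ p v' = fderiv ℝ f 0 v' * fderiv ℝ φ p e := by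
      intro v'
      have hφd : HasFDerivAt φ (fderiv ℝ φ p) (graphMap p e f 0) := by
        rw [graphMap_zero hf0]; exact (hφk.self_of_nhds.differentiableAt hk).hasFDerivAt
      have d1 := hφd.comp _ (hasFDerivAt_graphMap (p := p) hfd)
      have d2 : HasFDerivAt (φ ∘ graphMap p e f) (0 : (ℝ ∙ e)ᗮ →L[ℝ] ℝ) 0 :=
        (hasFDerivAt_const (φ p) (0 : (ℝ ∙ e)ᗮ)).congr_of_eventuallyEq (hf.mono fun v hv => hv.1)
      have := DFunLike.congr_fun (d1.unique d2) v'
      simp only [ContinuousLinearMap.comp_apply, sub_apply, map_sub,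
        Submodule.subtypeL_apply, ContinuousLinearMap.smulRight_apply, map_smul, smul_eq_mul,
        zero_apply] at this
      linarith
    obtain ⟨v', s, hvs⟩ := exists_eq_add_smul e u
    have h3 : ⟪u, u⟫_ℝ = ⟪u, e⟫_ℝ * (fderiv ℝ f 0 v' + s) := by
      have : ⟪u, v' + s • e⟫_ℝ = ⟪u, e⟫_ℝ * (fderiv ℝ f 0 v' + s) := by
        rw [inner_add_right, h1, real_inner_smul_right]; ring
      rwa [← hvs] at this
    have h4 : fderiv ℝ φ p u = (fderiv ℝ f 0 v' + s) * fderiv ℝ φ p e := by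
      rw [hvs, map_add, map_smul, h2, smul_eq_mul]; ring
    rw [h4]
    refine mul_ne_zero (fun h => ?_) he
    rw [h, mul_zero] at h3
    exact hu.ne_zero (inner_self_eq_zero.mp h3)
  obtain ⟨f, hf0, hf⟩ := exists_graphMap_of_fderiv_ne_zero hk hφk hφu
  exact ⟨f, hu, hf0, hf.mono fun v hv => hv.2, hmem hf0 hf⟩

end Graph

/-! ### Normals and curvature in terms of the graph -/

section Normal

local notation "E" => EuclideanSpace ℝ (Fin n)

theorem inner_graphNormal_self {u : E} (hu : ‖u‖ = 1) (f : (ℝ ∙ u)ᗮ → ℝ) (v : (ℝ ∙ u)ᗮ) :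
    ⟪graphNormal u f v, u⟫_ℝ = 1 := by
  rw [graphNormal, inner_add_left, inner_coe_orthogonal', real_inner_self_eq_norm_sq, hu]
  norm_num

theorem graphNormal_ne_zero {u : E} (hu : ‖u‖ = 1) (f : (ℝ ∙ u)ᗮ → ℝ) (v : (ℝ ∙ u)ᗮ) :
    graphNormal u f v ≠ 0 := by
  intro h
  have := inner_graphNormal_self hu f v
  rw [h, inner_zero_left] at this
  exact one_ne_zero this.symm

/-- The vertical displacement of a point `x` from the graph of `f`. -/
theorem eq_graphMap_add_smul {u : E} (hu : ‖u‖ = 1) (p : E) (f : (ℝ ∙ u)ᗮ → ℝ) (x : E) :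
    x = graphMap p u f ((ℝ ∙ u)ᗮ.orthogonalProjectionOnto (x - p)) +
      (f ((ℝ ∙ u)ᗮ.orthogonalProjectionOnto (x - p)) + ⟪u, x - p⟫_ℝ) • u := by
  obtain ⟨v, s, hvs⟩ := exists_eq_add_smul u (x - p)
  have h1 : (ℝ ∙ u)ᗮ.orthogonalProjectionOnto (x - p) = v := by
    rw [hvs, map_add, map_smul, Submodule.orthogonalProjectionOnto_mem_subspace_eq_self,
      Submodule.orthogonalProjectionOnto_orthogonalComplement_singleton_eq_zero, smul_zero,
      add_zero]
  have h2 : ⟪u, x - p⟫_ℝ = s := by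
    rw [hvs, inner_add_right, inner_coe_orthogonal, real_inner_smul_right,
      real_inner_self_eq_norm_sq, hu]
    ring
  rw [h1, h2, graphMap, eq_add_of_sub_eq hvs]
  module

namespace IsBoundaryGraph

variable {k : ℕ∞ω} {K : Set (EuclideanSpace ℝ (Fin n))} {p u : EuclideanSpace ℝ (Fin n)}
  {f : (ℝ ∙ u)ᗮ → ℝ}

theorem differentiableAt (h : IsBoundaryGraph k K p u f) (hk : k ≠ 0) : DifferentiableAt ℝ f 0 :=
  h.contDiffAt.self_of_nhds.differentiableAt hk

theorem fderiv_eq_zero (h : IsBoundaryGraph k K p u f) (hk : k ≠ 0) (hc : IsClosed K) :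
    fderiv ℝ f 0 = 0 := by
  ext v
  have h1 := inner_eq_of_support_graphMap (w := u) (h.differentiableAt hk)
    (h.mem_frontier.mono fun v hv => hc.frontier_subset hv)
    (by rw [graphMap_zero h.zero]; exact h.normal.2.2) v
  rw [inner_coe_orthogonal, real_inner_self_eq_norm_sq, h.normal.2.1] at h1
  simpa using h1.symm

theorem gradient_eq_zero (h : IsBoundaryGraph k K p u f) (hk : k ≠ 0) (hc : IsClosed K) :
    gradient f 0 = 0 := by
  rw [gradient, h.fderiv_eq_zero hk hc, map_zero]

theorem graphNormal_zero (h : IsBoundaryGraph k K p u f) (hk : k ≠ 0) (hc : IsClosed K) :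
    graphNormal u f 0 = u := by
  simp [graphNormal, h.gradient_eq_zero hk hc]

theorem tendsto_graphMap (h : IsBoundaryGraph k K p u f) (hk : k ≠ 0) :
    Tendsto (graphMap p u f) (𝓝 0) (𝓝 p) := by
  have := (hasFDerivAt_graphMap (p := p) (h.differentiableAt hk)).continuousAt
  rwa [ContinuousAt, graphMap_zero h.zero] at this

/-- The tangent cone of a differentiable convex body at `p` is a half-space, so the inner normal at
`p` points into the interior. -/
theorem exists_sub_smul_mem_interior (h : IsBoundaryGraph k K p u f) (hk : k ≠ 0)
    (hK : IsConvexBody K) : ∃ ε : ℝ, 0 < ε ∧ p - ε • u ∈ interior K := by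
  obtain ⟨c, hc⟩ := hK.nonempty_interior
  obtain ⟨v, s, hvs⟩ := exists_eq_add_smul u (c - p)
  have hcp : c = p + (v + s • u) := by rw [← hvs]; abel
  have hs : s < 0 := by
    have h1 := inner_lt_of_mem_interior h.normal.ne_zero h.normal.2.2 hc
    rw [hcp, inner_add_right, inner_add_right, inner_coe_orthogonal, real_inner_smul_right,
      real_inner_self_eq_norm_sq, h.normal.2.1] at h1
    linarith
  have hline : HasDerivAt (fun δ : ℝ => δ • (-v)) (-v) 0 := by
    simpa using (hasDerivAt_id (0 : ℝ)).smul_const (-v)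
  have hd : HasDerivAt (fun δ : ℝ => f (δ • (-v))) 0 0 := by
    have h1 : HasFDerivAt f (0 : (ℝ ∙ u)ᗮ →L[ℝ] ℝ) ((0 : ℝ) • (-v)) := by
      rw [zero_smul, ← h.fderiv_eq_zero hk hK.isClosed]
      exact (h.differentiableAt hk).hasFDerivAt
    simpa [Function.comp_def] using h1.comp_hasDerivAt (0 : ℝ) hline
  have hslope := hd.tendsto_slope_zero_right.eventually (lt_mem_nhds hs)
  have hmem : ∀ᶠ δ : ℝ in 𝓝[>] 0, graphMap p u f (δ • (-v)) ∈ frontier K := by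
    have ht : Tendsto (fun δ : ℝ => δ • (-v)) (𝓝[>] 0) (𝓝 0) := by
      have := hline.continuousAt.tendsto.mono_left (nhdsWithin_le_nhds (s := Set.Ioi 0))
      simpa using this
    exact ht.eventually h.mem_frontier
  -- The midpoint of a boundary point over `-δ v` and a point of the segment from `p` to `c`, the
  -- horizontal component of which is `δ v`, lies on the inner normal.
  obtain ⟨δ, hδs, hδm, hδ⟩ := (hslope.and (hmem.and (Ioc_mem_nhdsGT one_pos))).exists
  refine ⟨2⁻¹ * (f (δ • (-v)) - δ * s), ?_, ?_⟩
  · simp only [zero_add, zero_smul, h.zero, sub_zero, smul_eq_mul] at hδs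
    have h2 : δ * s < δ * (δ⁻¹ * f (δ • (-v))) := mul_lt_mul_of_pos_left hδs hδ.1
    rw [mul_inv_cancel_left₀ hδ.1.ne'] at h2
    linarith
  · have h1 : p + δ • (c - p) ∈ interior K :=
      hK.convex.add_smul_sub_mem_interior h.normal.1 hc hδ
    have h2 := hK.convex.combo_interior_self_mem_interior h1 (hK.isClosed.frontier_subset hδm)
      (a := 2⁻¹) (b := 2⁻¹) (by norm_num) (by norm_num) (by norm_num)
    convert h2 using 1
    rw [hvs, graphMap]
    push_cast
    module

/-- Near `p`, the only outward unit normal at a boundary point is the normal of the graph. -/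
theorem eventually_normal_eq (h : IsBoundaryGraph k K p u f) (hk : k ≠ 0) (hK : IsConvexBody K) :
    ∀ᶠ v in 𝓝 0, ∀ w, IsOutwardUnitNormal K (graphMap p u f v) w →
      w = ‖graphNormal u f v‖⁻¹ • graphNormal u f v := by
  obtain ⟨ε, hε, hint⟩ := h.exists_sub_smul_mem_interior hk hK
  have hint' : ∀ᶠ v in 𝓝 0, graphMap p u f v - ε • u ∈ interior K :=
    ((h.tendsto_graphMap hk).sub_const (ε • u)).eventually_mem (isOpen_interior.mem_nhds hint)
  filter_upwards [hint', h.contDiffAt, h.mem_frontier.eventually_nhds] with v h1 h2 h3 w hw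
  have h4 := eq_smul_of_support_graphMap h.normal.2.1 (h2.differentiableAt hk)
    (h3.mono fun v hv => hK.isClosed.frontier_subset hv) hw.2.2
  have h5 := inner_lt_of_mem_interior hw.ne_zero hw.2.2 h1
  rw [inner_sub_right, real_inner_smul_right] at h5
  have hpos : 0 < ⟪w, u⟫_ℝ := pos_of_mul_pos_right (b := ⟪w, u⟫_ℝ) (by linarith) hε.le
  have h6 := hw.2.1
  rw [h4, norm_smul, Real.norm_of_nonneg hpos.le] at h6
  rw [← eq_inv_of_mul_eq_one_left h6]
  exact h4

/-- Near `p`, the normal of the graph is an outward normal of the whole body. -/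
theorem eventually_inner_graphNormal_le (h : IsBoundaryGraph k K p u f) (hk : k ≠ 0)
    (hK : IsConvexBody K) : ∀ᶠ v in 𝓝 0, ∀ x ∈ K,
      ⟪graphNormal u f v, x⟫_ℝ ≤ ⟪graphNormal u f v, graphMap p u f v⟫_ℝ := by
  filter_upwards [h.eventually_normal_eq hk hK, h.mem_frontier] with v h1 h2 x hx
  obtain ⟨w, hw⟩ := hK.exists_normal h2
  have h3 := hw.2.2 x hx
  rw [h1 w hw, real_inner_smul_left, real_inner_smul_left] at h3
  exact le_of_mul_le_mul_left h3
    (inv_pos.mpr (norm_pos_iff.mpr (graphNormal_ne_zero h.normal.2.1 f v)))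

theorem normal_unique (h : IsBoundaryGraph k K p u f) (hk : k ≠ 0) (hK : IsConvexBody K) {w : E}
    (hw : IsOutwardUnitNormal K p w) : w = u := by
  have h1 := (h.eventually_normal_eq hk hK).self_of_nhds w (by rwa [graphMap_zero h.zero])
  rwa [h.graphNormal_zero hk hK.isClosed, h.normal.2.1, inv_one, one_smul] at h1

/-- The graph is the whole boundary near `p`. -/
theorem eventually_mem_frontier_iff (h : IsBoundaryGraph k K p u f) (hk : k ≠ 0)
    (hK : IsConvexBody K) : ∀ᶠ x in 𝓝 p,
      x ∈ frontier K ↔ f ((ℝ ∙ u)ᗮ.orthogonalProjectionOnto (x - p)) + ⟪u, x - p⟫_ℝ = 0 := by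
  obtain ⟨ε, hε, hint⟩ := h.exists_sub_smul_mem_interior hk hK
  set π : E → (ℝ ∙ u)ᗮ := fun x => (ℝ ∙ u)ᗮ.orthogonalProjectionOnto (x - p) with hπ
  have hπc : Tendsto π (𝓝 p) (𝓝 0) := by
    have : Continuous π := by fun_prop
    exact this.tendsto' _ _ (by simp [hπ])
  have hdec : ∀ x, x = graphMap p u f (π x) + (f (π x) + ⟪u, x - p⟫_ℝ) • u :=
    eq_graphMap_add_smul h.normal.2.1 p f
  have hτ : Tendsto (fun x => f (π x) + ⟪u, x - p⟫_ℝ) (𝓝 p) (𝓝 0) := by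
    have h1 : Tendsto (fun x => f (π x)) (𝓝 p) (𝓝 0) := by
      have := (h.differentiableAt hk).continuousAt.tendsto
      rw [h.zero] at this
      exact this.comp hπc
    have h2 : Tendsto (fun x => ⟪u, x - p⟫_ℝ) (𝓝 p) (𝓝 0) := by
      have : Continuous fun x => ⟪u, x - p⟫_ℝ := by fun_prop
      exact this.tendsto' _ _ (by simp)
    simpa using h1.add h2
  have e1 : ∀ᶠ x in 𝓝 p, x - ε • u ∈ interior K :=
    (tendsto_id.sub_const (ε • u)).eventually_mem (isOpen_interior.mem_nhds hint)
  have e2 : ∀ᶠ x in 𝓝 p, graphMap p u f (π x) - ε • u ∈ interior K :=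
    (((h.tendsto_graphMap hk).comp hπc).sub_const (ε • u)).eventually_mem
      (isOpen_interior.mem_nhds hint)
  filter_upwards [e1, e2, hπc.eventually h.mem_frontier,
    hτ.eventually (Ioo_mem_nhds (neg_lt_zero.mpr hε) hε)] with x hx1 hx2 hx3 hx4
  have hdx := hdec x
  set q := graphMap p u f (π x) with hq
  set τ := f (π x) + ⟪u, x - p⟫_ℝ with hτd
  -- For `y ∈ K` with `y - ε u` in the interior, so is `y - t u` for `0 < t < ε`.
  have hseg : ∀ y ∈ K, y - ε • u ∈ interior K → ∀ t, 0 < t → t < ε → y - t • u ∈ interior K := by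
    intro y hy hyi t ht htε
    have h1 := hK.convex.combo_interior_self_mem_interior hyi hy (a := t / ε) (b := 1 - t / ε)
      (by positivity) (by rw [sub_nonneg, div_le_one hε]; exact htε.le) (by ring)
    convert h1 using 1
    have : t • u = (t / ε) • ε • u := by rw [smul_smul, div_mul_cancel₀ _ hε.ne']
    rw [this]
    module
  constructor
  · intro hxF
    rcases lt_trichotomy τ 0 with hneg | h0 | hpos
    · have := hseg q (hK.isClosed.frontier_subset hx3) hx2 (-τ) (by linarith) (by linarith [hx4.1])
      rw [neg_smul, sub_neg_eq_add, ← hdx] at this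
      exact (hxF.2 this).elim
    · exact h0
    · have := hseg x (hK.isClosed.frontier_subset hxF) hx1 τ hpos hx4.2
      rw [show x - τ • u = q by nth_rewrite 1 [hdx]; abel] at this
      exact (hx3.2 this).elim
  · intro h0
    rw [h0, zero_smul, add_zero] at hdx
    rw [hdx]
    exact hx3

end IsBoundaryGraph

/-- A convex body is of class `C^k` if its boundary contains a `C^k` graph around each of its
points. -/
theorem isOfClass_of_isBoundaryGraph {k : ℕ∞ω} (hk : k ≠ 0) {K : Set E} (hK : IsConvexBody K)
    (h : ∀ p ∈ frontier K, ∃ u f, IsBoundaryGraph k K p u f) : IsOfClass k K := by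
  intro p hp
  obtain ⟨u, f, hf⟩ := h p hp
  set L : E →L[ℝ] (ℝ ∙ u)ᗮ := (ℝ ∙ u)ᗮ.orthogonalProjectionOnto with hL
  set φ : E → ℝ := fun x => f (L (x - p)) + ⟪u, x - p⟫_ℝ with hφ
  have hLc : Tendsto (fun x => L (x - p)) (𝓝 p) (𝓝 0) := by
    have : Continuous fun x => L (x - p) := by fun_prop
    exact this.tendsto' _ _ (by simp)
  have hφk : ∀ᶠ x in 𝓝 p, ContDiffAt ℝ k φ x := by
    filter_upwards [hLc.eventually hf.contDiffAt] with x hx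
    exact (hx.comp x (L.contDiff.contDiffAt.comp x (contDiffAt_id.sub contDiffAt_const))).add
      (contDiffAt_const.inner ℝ (contDiffAt_id.sub contDiffAt_const))
  obtain ⟨U, hU, hUo, hpU⟩ :=
    eventually_nhds_iff.mp (hφk.and (hf.eventually_mem_frontier_iff hk hK))
  refine ⟨U, φ, hUo, hpU, fun x hx => (hU x hx).1.contDiffWithinAt, fun h0 => ?_, ?_⟩
  · have hLu : L u = 0 :=
      Submodule.orthogonalProjectionOnto_orthogonalComplement_singleton_eq_zero u
    have hline : HasDerivAt (fun t : ℝ => p + t • u) u 0 := by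
      simpa using ((hasDerivAt_id (0 : ℝ)).smul_const u).const_add p
    have hd : HasFDerivAt φ (0 : E →L[ℝ] ℝ) (p + (0 : ℝ) • u) := by
      rw [zero_smul, add_zero, ← h0]
      exact (hφk.self_of_nhds.differentiableAt hk).hasFDerivAt
    have h1 := hd.comp_hasDerivAt (0 : ℝ) hline
    have h2 : φ ∘ (fun t : ℝ => p + t • u) = fun t => t := by
      funext t
      simp only [hφ, Function.comp_apply, add_sub_cancel_left, map_smul, hLu, smul_zero, hf.zero,
        real_inner_smul_right, real_inner_self_eq_norm_sq, hf.normal.2.1]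
      ring
    rw [h2] at h1
    simpa using h1.unique (hasDerivAt_id (0 : ℝ))
  · ext x
    exact ⟨fun hx => ⟨hx.2, (hU x hx.2).2.mp hx.1⟩, fun hx => ⟨(hU x hx.1).2.mpr hx.2, hx.1⟩⟩

end Normal

section Curvature

local notation "E" => EuclideanSpace ℝ (Fin n)

/-- At a critical point of `f`, the derivative of the unit normal of its graph is the Hessian. -/
theorem hasFDerivAt_unitNormal {u : E} (hu : ‖u‖ = 1) {f : (ℝ ∙ u)ᗮ → ℝ}
    (hf0 : gradient f 0 = 0) (hd : DifferentiableAt ℝ (gradient f) 0) :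
    HasFDerivAt (fun v => ‖graphNormal u f v‖⁻¹ • graphNormal u f v)
      ((ℝ ∙ u)ᗮ.subtypeL ∘L fderiv ℝ (gradient f) 0) 0 := by
  have hN0 : graphNormal u f 0 = u := by simp [graphNormal, hf0]
  have hN : HasFDerivAt (graphNormal u f) ((ℝ ∙ u)ᗮ.subtypeL ∘L fderiv ℝ (gradient f) 0) 0 :=
    (((ℝ ∙ u)ᗮ.subtypeL.hasFDerivAt).comp (0 : (ℝ ∙ u)ᗮ) hd.hasFDerivAt).const_add u
  have hsq : HasFDerivAt (fun v => ‖graphNormal u f v‖ ^ 2) (0 : (ℝ ∙ u)ᗮ →L[ℝ] ℝ) 0 := by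
    refine hN.norm_sq.congr_fderiv ?_
    ext w
    simp [hN0, inner_coe_orthogonal]
  have hinv : HasFDerivAt (fun v => ‖graphNormal u f v‖⁻¹) (0 : (ℝ ∙ u)ᗮ →L[ℝ] ℝ) 0 := by
    have h1 : HasDerivAt (fun t : ℝ => (√t)⁻¹) (-(1 / (2 * √1)) / √1 ^ 2)
        (‖graphNormal u f 0‖ ^ 2) := by
      rw [hN0, hu, one_pow]
      exact (Real.hasDerivAt_sqrt one_ne_zero).inv (by simp)
    have h2 := h1.comp_hasFDerivAt (0 : (ℝ ∙ u)ᗮ) hsq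
    have h3 : (fun t : ℝ => (√t)⁻¹) ∘ (fun v => ‖graphNormal u f v‖ ^ 2) =
        fun v => ‖graphNormal u f v‖⁻¹ := by
      funext v
      simp
    rw [h3] at h2
    simpa using h2
  refine (hinv.smul hN).congr_fderiv ?_
  ext w
  simp [hN0, hu]

namespace IsBoundaryGraph

variable {k : ℕ∞ω} {K : Set (EuclideanSpace ℝ (Fin n))} {p u : EuclideanSpace ℝ (Fin n)}
  {f : (ℝ ∙ u)ᗮ → ℝ}

theorem differentiableAt_gradient (h : IsBoundaryGraph k K p u f) (hk : 2 ≤ k) :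
    DifferentiableAt ℝ (gradient f) 0 :=
  (contDiffAt_gradient (m := 1) (by norm_num) (h.contDiffAt.self_of_nhds.of_le hk)).differentiableAt
    one_ne_zero

/-- The Hessian is the derivative of the gradient, which satisfies `0 ≤ ⟪∇f v, v⟫` near `0`, since
the graph lies above the tangent hyperplanes at `0` and at `v`. -/
theorem inner_hessian_nonneg (h : IsBoundaryGraph k K p u f) (hk : 2 ≤ k) (hK : IsConvexBody K)
    (w : (ℝ ∙ u)ᗮ) : 0 ≤ ⟪fderiv ℝ (gradient f) 0 w, w⟫_ℝ := by
  have hk0 : k ≠ 0 := by rintro rfl; simp at hk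
  have hmono : ∀ᶠ v in 𝓝 0, 0 ≤ ⟪gradient f v, v⟫_ℝ := by
    filter_upwards [h.eventually_inner_graphNormal_le hk0 hK, h.mem_frontier] with v h1 h2
    have h3 := h1 p h.normal.1
    have h4 := h.normal.2.2 _ (hK.isClosed.frontier_subset h2)
    rw [graphMap, add_sub_assoc, inner_add_right, inner_sub_right, inner_coe_orthogonal,
      real_inner_smul_right, real_inner_self_eq_norm_sq, h.normal.2.1] at h4
    rw [graphMap, add_sub_assoc, inner_add_right, inner_sub_right, real_inner_smul_right,
      inner_graphNormal_self h.normal.2.1, graphNormal, inner_add_left _ _ (v : E),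
      inner_coe_orthogonal, ← Submodule.coe_inner] at h3
    linarith
  have hline : HasDerivAt (fun t : ℝ => t • w) w 0 := by
    simpa using (hasDerivAt_id (0 : ℝ)).smul_const w
  have hd : HasDerivAt (fun t : ℝ => ⟪gradient f (t • w), w⟫_ℝ)
      ⟪fderiv ℝ (gradient f) 0 w, w⟫_ℝ 0 := by
    have h1 : HasFDerivAt (gradient f) (fderiv ℝ (gradient f) 0) ((0 : ℝ) • w) := by
      rw [zero_smul]; exact (h.differentiableAt_gradient hk).hasFDerivAt
    simpa using (h1.comp_hasDerivAt (0 : ℝ) hline).inner ℝ (hasDerivAt_const (0 : ℝ) w)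
  refine ge_of_tendsto hd.tendsto_slope_zero_right ?_
  have ht : Tendsto (fun t : ℝ => t • w) (𝓝[>] 0) (𝓝 0) := by
    have := hline.continuousAt.tendsto.mono_left (nhdsWithin_le_nhds (s := Set.Ioi 0))
    simpa using this
  filter_upwards [ht.eventually hmono, self_mem_nhdsWithin] with t h1 (h2 : 0 < t)
  rw [real_inner_smul_right] at h1
  simp only [zero_add, zero_smul, h.gradient_eq_zero hk0 hK.isClosed, inner_zero_left, sub_zero,
    smul_eq_mul]
  exact mul_nonneg (inv_pos.mpr h2).le (nonneg_of_mul_nonneg_right h1 h2)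

/-- Every Gauss map is differentiable within the boundary, with the Hessian of the graph as its
derivative. -/
theorem hasFDerivWithinAt_gaussMap (h : IsBoundaryGraph k K p u f) (hk : 2 ≤ k)
    (hK : IsConvexBody K) {ν : E → E} (hν : IsGaussMap K ν) :
    HasFDerivWithinAt ν ((ℝ ∙ u)ᗮ.subtypeL ∘L fderiv ℝ (gradient f) 0 ∘L
      (ℝ ∙ u)ᗮ.orthogonalProjectionOnto) (frontier K) p := by
  have hk0 : k ≠ 0 := by rintro rfl; simp at hk
  set L : E →L[ℝ] (ℝ ∙ u)ᗮ := (ℝ ∙ u)ᗮ.orthogonalProjectionOnto with hL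
  have hLd : HasFDerivAt (fun x => L (x - p)) L p :=
    L.hasFDerivAt.comp p ((hasFDerivAt_id p).sub_const p)
  have hd : HasFDerivAt (fun x => ‖graphNormal u f (L (x - p))‖⁻¹ • graphNormal u f (L (x - p)))
      (((ℝ ∙ u)ᗮ.subtypeL ∘L fderiv ℝ (gradient f) 0) ∘L L) p := by
    refine HasFDerivAt.comp (g := fun v => ‖graphNormal u f v‖⁻¹ • graphNormal u f v) p ?_ hLd
    simpa using hasFDerivAt_unitNormal h.normal.2.1 (h.gradient_eq_zero hk0 hK.isClosed)
      (h.differentiableAt_gradient hk)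
  have hLc : Tendsto (fun x => L (x - p)) (𝓝 p) (𝓝 0) := by
    simpa using hLd.continuousAt.tendsto
  have hev : ∀ᶠ x in 𝓝[frontier K] p,
      ν x = ‖graphNormal u f (L (x - p))‖⁻¹ • graphNormal u f (L (x - p)) := by
    filter_upwards [nhdsWithin_le_nhds (hLc.eventually (h.eventually_normal_eq hk0 hK)),
      nhdsWithin_le_nhds (h.eventually_mem_frontier_iff hk0 hK), self_mem_nhdsWithin]
      with x h1 h2 h3
    refine h1 _ ?_
    have h4 := eq_graphMap_add_smul h.normal.2.1 p f x
    rw [h2.mp h3, zero_smul, add_zero] at h4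
    rw [← h4]
    exact hν x h3
  exact hd.hasFDerivWithinAt.congr_of_eventuallyEq hev
    (hev.self_of_nhdsWithin h.normal.mem_frontier)

/-- Positive curvature of `K` at `p` means that the Hessian of the graph is nonsingular. -/
theorem hessian_injective (h : IsBoundaryGraph k K p u f) (hk : 2 ≤ k) (hK : IsConvexBody K)
    (hpos : IsPositivelyCurved K) (w : (ℝ ∙ u)ᗮ) (hw : fderiv ℝ (gradient f) 0 w = 0) : w = 0 := by
  have hk0 : k ≠ 0 := by rintro rfl; simp at hk
  obtain ⟨-, ν, hν, hD⟩ := hpos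
  obtain ⟨D, hD, hinj⟩ := hD p h.normal.mem_frontier
  have hνp : ν p = u := h.normal_unique hk0 hK (hν p h.normal.mem_frontier)
  -- The derivatives of a function within the boundary agree on tangent vectors.
  have hg : HasFDerivAt (graphMap p u f) (ℝ ∙ u)ᗮ.subtypeL 0 := by
    simpa [h.fderiv_eq_zero hk0 hK.isClosed] using
      hasFDerivAt_graphMap (p := p) (h.differentiableAt hk0)
  have h1 : HasFDerivAt (ν ∘ graphMap p u f) (D ∘L (ℝ ∙ u)ᗮ.subtypeL) 0 := by
    refine HasFDerivWithinAt.comp_hasFDerivAt (0 : (ℝ ∙ u)ᗮ) ?_ hg h.mem_frontier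
    rwa [graphMap_zero h.zero]
  have h2 : HasFDerivAt (ν ∘ graphMap p u f) (((ℝ ∙ u)ᗮ.subtypeL ∘L fderiv ℝ (gradient f) 0 ∘L
      (ℝ ∙ u)ᗮ.orthogonalProjectionOnto) ∘L (ℝ ∙ u)ᗮ.subtypeL) 0 := by
    refine HasFDerivWithinAt.comp_hasFDerivAt (0 : (ℝ ∙ u)ᗮ) ?_ hg h.mem_frontier
    rw [graphMap_zero h.zero]
    exact h.hasFDerivWithinAt_gaussMap hk hK hν
  have h3 := DFunLike.congr_fun (h1.unique h2) w
  simp only [ContinuousLinearMap.comp_apply, Submodule.subtypeL_apply,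
    Submodule.orthogonalProjectionOnto_mem_subspace_eq_self, hw, ZeroMemClass.coe_zero] at h3
  exact Subtype.ext (hinj w (by rw [hνp]; exact inner_coe_orthogonal' w) h3)

end IsBoundaryGraph

/-- Positive curvature, from nonsingular Hessians of graphs representing the boundary. -/
theorem isPositivelyCurved_of_isBoundaryGraph {K : Set E} (hK : IsConvexBody K)
    (h : ∀ p ∈ frontier K, ∃ u f, IsBoundaryGraph 2 K p u f ∧
      ∀ w, fderiv ℝ (gradient f) 0 w = 0 → w = 0) : IsPositivelyCurved K := by
  refine ⟨isOfClass_of_isBoundaryGraph two_ne_zero hK fun p hp => ?_, ?_⟩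
  · obtain ⟨u, f, hf, -⟩ := h p hp
    exact ⟨u, f, hf⟩
  have hex : ∀ p, ∃ w, p ∈ frontier K → IsOutwardUnitNormal K p w := fun p => by
    by_cases hp : p ∈ frontier K
    · exact (hK.exists_normal hp).imp fun w hw _ => hw
    · exact ⟨0, fun h => (hp h).elim⟩
  choose ν hν using hex
  refine ⟨ν, hν, fun p hp => ?_⟩
  obtain ⟨u, f, hf, hinj⟩ := h p hp
  refine ⟨_, hf.hasFDerivWithinAt_gaussMap le_rfl hK hν, fun v hv hDv => ?_⟩
  rw [hf.normal_unique two_ne_zero hK (hν p hp)] at hv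
  obtain ⟨w, rfl⟩ : ∃ w : (ℝ ∙ u)ᗮ, (w : E) = v :=
    ⟨⟨v, Submodule.mem_orthogonal_singleton_iff_inner_left.mpr hv⟩, rfl⟩
  simp only [ContinuousLinearMap.comp_apply, Submodule.subtypeL_apply,
    Submodule.orthogonalProjectionOnto_mem_subspace_eq_self, ZeroMemClass.coe_eq_zero] at hDv
  rw [hinj w hDv, ZeroMemClass.coe_zero]

/-! ### The boundary of a Minkowski sum -/

/-- If the boundaries of `K₀` and `K₁` are graphs over parallel support hyperplanes at `a` and `b`,
and one of them is positively curved, then the boundary of `K₀ + K₁` is at `a + b` the graph of the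
infimal convolution. Boundary points of the summands with the same normal add up to boundary points
of the sum. -/
theorem IsBoundaryGraph.exists_add {k m : ℕ∞ω} (hm : m ≠ 0) (hkm : k = m + 1) {K₀ K₁ : Set E}
    (h₀ : IsConvexBody K₀) (h₁ : IsConvexBody K₁) {a b u : E} {f g : (ℝ ∙ u)ᗮ → ℝ}
    (hu : IsOutwardUnitNormal (K₀ + K₁) (a + b) u)
    (hf : IsBoundaryGraph k K₀ a u f) (hg : IsBoundaryGraph k K₁ b u g)
    (hinj : ∀ w, fderiv ℝ (gradient f) 0 w = 0 → w = 0) :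
    ∃ h, IsBoundaryGraph k (K₀ + K₁) (a + b) u h ∧
      ((∀ w, fderiv ℝ (gradient g) 0 w = 0 → w = 0) →
        ∀ w, fderiv ℝ (gradient h) 0 w = 0 → w = 0) := by
  have hk2 : 2 ≤ k := by
    have := ENat.one_le_iff_ne_zero_withTop.mpr hm
    rw [hkm]; exact (by norm_num : (2 : ℕ∞ω) = 1 + 1).trans_le (by gcongr)
  have hk0 : k ≠ 0 := by rintro rfl; simp at hk2
  obtain ⟨η, hη0, hηc, hηeq, hh, hhinj⟩ := exists_infConvolution hm hkm hf.contDiffAt hg.contDiffAt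
    (hf.gradient_eq_zero hk0 h₀.isClosed) (hg.gradient_eq_zero hk0 h₁.isClosed)
    (hf.inner_hessian_nonneg hk2 h₀) (hg.inner_hessian_nonneg hk2 h₁) hinj
  have hyt : Tendsto η (𝓝 0) (𝓝 0) := by simpa [ContinuousAt, hη0] using hηc
  have hxt : Tendsto (fun v => v - η v) (𝓝 0) (𝓝 0) := by
    simpa using (tendsto_id (x := 𝓝 (0 : (ℝ ∙ u)ᗮ))).sub hyt
  refine ⟨_, ⟨hu, by simp [hη0, hf.zero, hg.zero], hh, ?_⟩, hhinj⟩
  filter_upwards [hηeq, hxt.eventually (hf.eventually_inner_graphNormal_le hk0 h₀),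
    hyt.eventually (hg.eventually_inner_graphNormal_le hk0 h₁), hxt.eventually hf.mem_frontier,
    hyt.eventually hg.mem_frontier] with v e h2 h3 h4 h5
  have hN : graphNormal u f (v - η v) = graphNormal u g (η v) := by rw [graphNormal, e, graphNormal]
  have hsum : graphMap (a + b) u (fun v => f (v - η v) + g (η v)) v =
      graphMap a u f (v - η v) + graphMap b u g (η v) := by
    simp only [graphMap]
    push_cast
    module
  rw [hsum]
  refine mem_frontier_of_support
    (Set.add_mem_add (h₀.isClosed.frontier_subset h4) (h₁.isClosed.frontier_subset h5))
    (graphNormal_ne_zero hu.2.1 f (v - η v)) fun y hy => ?_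
  obtain ⟨x₀, hx₀, x₁, hx₁, rfl⟩ := Set.mem_add.mp hy
  rw [inner_add_right, inner_add_right]
  exact add_le_add (h2 x₀ hx₀) (by rw [hN]; exact h3 x₁ hx₁)

/-- At each boundary point, the sum of two bodies of class `C^k` one of which is positively curved
is bounded by a `C^k` graph. -/
theorem exists_isBoundaryGraph_add {k m : ℕ∞ω} (hm : m ≠ 0) (hkm : k = m + 1) {K₀ K₁ : Set E}
    (h₀ : IsConvexBody K₀) (h₁ : IsConvexBody K₁) (hc : IsClosed (K₀ + K₁))
    (hk₀ : IsOfClass k K₀) (hk₁ : IsOfClass k K₁) (hpos : IsPositivelyCurved K₀)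
    {p : E} (hp : p ∈ frontier (K₀ + K₁)) :
    ∃ u h, IsBoundaryGraph k (K₀ + K₁) p u h ∧
      (IsPositivelyCurved K₁ → ∀ w, fderiv ℝ (gradient h) 0 w = 0 → w = 0) := by
  have hk2 : 2 ≤ k := by
    have := ENat.one_le_iff_ne_zero_withTop.mpr hm
    rw [hkm]; exact (by norm_num : (2 : ℕ∞ω) = 1 + 1).trans_le (by gcongr)
  have hk0 : k ≠ 0 := by rintro rfl; simp at hk2
  obtain ⟨u, hu⟩ := (h₀.add h₁ hc).exists_normal hp
  obtain ⟨a, ha, b, hb, rfl⟩ := Set.mem_add.mp hu.1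
  obtain ⟨f, hf⟩ := hk₀.exists_isBoundaryGraph hk0 h₀.isClosed (hu.left_of_add ha hb)
  obtain ⟨g, hg⟩ := hk₁.exists_isBoundaryGraph hk0 h₁.isClosed (hu.right_of_add ha hb)
  obtain ⟨h, hh, hinj⟩ := IsBoundaryGraph.exists_add hm hkm h₀ h₁ hu hf hg
    (hf.hessian_injective hk2 h₀ hpos)
  exact ⟨u, h, hh, fun hpos₁ => hinj (hg.hessian_injective hk2 h₁ hpos₁)⟩

theorem IsOfClass.add {k m : ℕ∞ω} (hm : m ≠ 0) (hkm : k = m + 1) {K₀ K₁ : Set E}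
    (h₀ : IsConvexBody K₀) (h₁ : IsConvexBody K₁) (hc : IsClosed (K₀ + K₁))
    (hk₀ : IsOfClass k K₀) (hk₁ : IsOfClass k K₁) (hpos : IsPositivelyCurved K₀) :
    IsOfClass k (K₀ + K₁) := by
  refine isOfClass_of_isBoundaryGraph (by rw [hkm]; simp) (h₀.add h₁ hc) fun p hp => ?_
  obtain ⟨u, h, hh, -⟩ := exists_isBoundaryGraph_add hm hkm h₀ h₁ hc hk₀ hk₁ hpos hp
  exact ⟨u, h, hh⟩

theorem IsPositivelyCurved.add {K₀ K₁ : Set E} (h₀ : IsConvexBody K₀) (h₁ : IsConvexBody K₁)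
    (hc : IsClosed (K₀ + K₁)) (hpos₀ : IsPositivelyCurved K₀) (hpos₁ : IsPositivelyCurved K₁) :
    IsPositivelyCurved (K₀ + K₁) := by
  refine isPositivelyCurved_of_isBoundaryGraph (h₀.add h₁ hc) fun p hp => ?_
  obtain ⟨u, h, hh, hinj⟩ := exists_isBoundaryGraph_add one_ne_zero one_add_one_eq_two.symm h₀ h₁ hc
    hpos₀.1 hpos₁.1 hpos₀ hp
  exact ⟨u, h, hh, hinj hpos₁⟩

end Curvature

/-! ### Bodies with unique normals are of class `C^1` -/

/-- A function with a continuous selection of subgradients is differentiable: the convexity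
inequalities at `x` and at `y` bound the remainder by `‖s y - s x‖ * ‖y - x‖`. -/
theorem hasGradientAt_of_subgradient {F : Type*} [NormedAddCommGroup F] [InnerProductSpace ℝ F]
    [CompleteSpace F] {G : F → ℝ} {s : F → F} {x : F}
    (h : ∀ᶠ y in 𝓝 x, ∀ z, G y + ⟪s y, z - y⟫_ℝ ≤ G z) (hs : ContinuousAt s x) :
    HasGradientAt G (s x) x := by
  rw [hasGradientAt_iff_isLittleO, Asymptotics.isLittleO_iff]
  intro ε hε
  filter_upwards [h, (Metric.continuousAt_iff'.mp hs) ε hε] with y hy hsy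
  have h1 := h.self_of_nhds y
  have h2 := hy x
  have h3 : ⟪s y - s x, y - x⟫_ℝ ≤ ε * ‖y - x‖ :=
    (real_inner_le_norm _ _).trans (by rw [dist_eq_norm] at hsy; gcongr)
  rw [inner_sub_left] at h3
  rw [← neg_sub y x, inner_neg_right] at h2
  rw [Real.norm_eq_abs, abs_le]
  constructor <;> linarith [mul_nonneg hε.le (norm_nonneg (y - x))]

section Gauge

local notation "E" => EuclideanSpace ℝ (Fin n)

/-- The graph of the normal cone is closed and unit vectors form a compact set, so unique normals
are continuous. -/
theorem IsGaussMap.continuousWithinAt {K : Set E} (hc : IsClosed K)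
    (huniq : ∀ p u w, IsOutwardUnitNormal K p u → IsOutwardUnitNormal K p w → u = w)
    {ν : E → E} (hν : IsGaussMap K ν) {p : E} (hp : p ∈ frontier K) :
    ContinuousWithinAt ν (frontier K) p := by
  refine (isCompact_sphere (0 : E) 1).tendsto_nhds_of_unique_mapClusterPt ?_ fun w hw hcl => ?_
  · filter_upwards [self_mem_nhdsWithin] with q hq
    simpa using (hν q hq).2.1
  · refine huniq p _ _ ⟨hc.frontier_subset hp, by simpa using hw, fun x hx => ?_⟩ (hν p hp)
    obtain ⟨U, hU, hUw⟩ := mapClusterPt_iff_ultrafilter.mp hcl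
    have hUp : Tendsto id (U : Filter E) (𝓝 p) := hU.trans nhdsWithin_le_nhds
    refine le_of_tendsto_of_tendsto (hUw.inner (tendsto_const_nhds (x := x))) (hUw.inner hUp) ?_
    filter_upwards [hU self_mem_nhdsWithin] with q hq using (hν q hq).2.2 x hx

/-- A convex body with a unique outward unit normal at each boundary point is of class `C^1`. The
defining function is the gauge with respect to an interior point. Its subgradients are multiples of
the normals, which depend continuously on the boundary point. -/
theorem isOfClass_one_of_unique_normal {K : Set E} (hK : IsConvexBody K)
    (huniq : ∀ p u w, IsOutwardUnitNormal K p u → IsOutwardUnitNormal K p w → u = w) :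
    IsOfClass 1 K := by
  obtain ⟨c, hc⟩ := hK.nonempty_interior
  have hex : ∀ p, ∃ w, p ∈ frontier K → IsOutwardUnitNormal K p w := fun p => by
    by_cases hp : p ∈ frontier K
    · exact (hK.exists_normal hp).imp fun w hw _ => hw
    · exact ⟨0, fun h => (hp h).elim⟩
  choose ν hν using hex
  have hνc := fun p hp => IsGaussMap.continuousWithinAt hK.isClosed huniq hν (p := p) hp
  set K' : Set E := (fun x => c + x) ⁻¹' K with hK'
  have hK'c : Convex ℝ K' := hK.convex.translate_preimage_right c
  have hK'0 : K' ∈ 𝓝 0 := by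
    refine (continuous_const.add continuous_id).continuousAt.preimage_mem_nhds ?_
    simpa using mem_interior_iff_mem_nhds.mp hc
  have hfr : ∀ x, x ∈ frontier K' ↔ c + x ∈ frontier K := fun x => by
    rw [hK', show (fun x => c + x) = Homeomorph.addLeft c from rfl,
      ← (Homeomorph.addLeft c).preimage_frontier]
    rfl
  set G : E → ℝ := fun x => gauge K' (x - c) with hG
  have hGc : Continuous G := (continuous_gauge hK'c hK'0).comp (continuous_id.sub continuous_const)
  have hG1 : ∀ x, G x = 1 ↔ x ∈ frontier K := fun x => by
    rw [hG]; simp only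
    rw [gauge_eq_one_iff_mem_frontier hK'c hK'0, hfr, add_sub_cancel]
  -- The radial projection `q` onto the boundary.
  set q : E → E := fun x => c + (G x)⁻¹ • (x - c) with hq
  have hqF : ∀ x, 0 < G x → q x ∈ frontier K := fun x hx => by
    rw [← hG1, hG]
    simp only [hq, add_sub_cancel_left]
    rw [gauge_smul_of_nonneg (inv_nonneg.mpr hx.le), smul_eq_mul]
    exact inv_mul_cancel₀ hx.ne'
  have hqc : ∀ x, 0 < G x → ContinuousAt q x := fun x hx =>
    continuousAt_const.add ((hGc.continuousAt.inv₀ hx.ne').smul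
      (continuousAt_id.sub continuousAt_const))
  set s : E → E := fun x => (⟪ν (q x), q x - c⟫_ℝ)⁻¹ • ν (q x) with hs
  have hpos : ∀ x, 0 < G x → 0 < ⟪ν (q x), q x - c⟫_ℝ := fun x hx => by
    have hn := hν _ (hqF x hx)
    have := inner_lt_of_mem_interior hn.ne_zero hn.2.2 hc
    rw [inner_sub_right]
    linarith
  have hUo : IsOpen {x | 0 < G x} := isOpen_lt continuous_const hGc
  have hsc : ∀ x, 0 < G x → ContinuousAt s x := fun x hx => by
    have h1 : ContinuousAt (fun y => ν (q y)) x := by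
      refine (hνc _ (hqF x hx)).tendsto.comp
        (tendsto_nhdsWithin_iff.mpr ⟨hqc x hx, ?_⟩)
      filter_upwards [hUo.mem_nhds hx] with y hy using hqF y hy
    exact ((h1.inner ((hqc x hx).sub continuousAt_const)).inv₀ (hpos x hx).ne').smul h1
  have hsx : ∀ x, 0 < G x → ⟪s x, x - c⟫_ℝ = G x := fun x hx => by
    have h1 : q x - c = (G x)⁻¹ • (x - c) := by simp [hq]
    have h2 := (hpos x hx).ne'
    have h3 : x - c = G x • (q x - c) := by rw [h1, smul_inv_smul₀ hx.ne']
    have h4 : ⟪s x, x - c⟫_ℝ = ⟪s x, G x • (q x - c)⟫_ℝ := by rw [← h3]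
    rw [h4, real_inner_smul_right, hs, real_inner_smul_left, inv_mul_cancel₀ h2, mul_one]
  have hsle : ∀ x, 0 < G x → ∀ z, ⟪s x, z - c⟫_ℝ ≤ G z := fun x hx z => by
    have hn := hν _ (hqF x hx)
    refine le_of_forall_gt_imp_ge_of_dense fun t ht => ?_
    obtain ⟨b, hb0, hbt, k, hk, hkz⟩ := exists_lt_of_gauge_lt (absorbent_nhds_zero hK'0) ht
    have h1 := hn.2.2 (c + k) hk
    have h2 : ⟪ν (q x), k⟫_ℝ ≤ ⟪ν (q x), q x - c⟫_ℝ := by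
      rw [inner_add_right] at h1
      rw [inner_sub_right]
      linarith
    have h3 : b • k = z - c := hkz
    rw [← h3, real_inner_smul_right, hs, real_inner_smul_left]
    refine le_trans ?_ hbt.le
    refine mul_le_of_le_one_right hb0.le ?_
    rwa [inv_mul_le_iff₀ (hpos x hx), mul_one]
  have hgrad : ∀ x, 0 < G x → HasGradientAt G (s x) x := fun x hx => by
    refine hasGradientAt_of_subgradient ?_ (hsc x hx)
    filter_upwards [hUo.mem_nhds hx] with y hy z
    have h1 := hsle y hy z
    rw [← sub_sub_sub_cancel_right z y c, inner_sub_right, hsx y hy]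
    linarith
  have hGk : ∀ x, 0 < G x → ContDiffAt ℝ 1 G x := fun x hx => by
    refine contDiffAt_of_hasGradientAt (m := 0) (F := s) (by simp) 
      (contDiffAt_zero.mpr ⟨_, univ_mem, hGc.continuousOn⟩) ?_ ?_
    · filter_upwards [hUo.mem_nhds hx] with y hy using hgrad y hy
    · exact contDiffAt_zero.mpr ⟨_, hUo.mem_nhds hx, fun y hy => (hsc y hy).continuousWithinAt⟩
  intro p hp
  have hGp : G p = 1 := (hG1 p).mpr hp
  have hGp0 : 0 < G p := by rw [hGp]; exact one_pos
  refine ⟨{x | 0 < G x}, fun x => G x - 1, hUo, hGp0,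
    fun x hx => ((hGk x hx).sub contDiffAt_const).contDiffWithinAt, fun h0 => ?_, ?_⟩
  · have h1 : fderiv ℝ (fun x => G x - 1) p = InnerProductSpace.toDual ℝ E (s p) :=
      ((hgrad p hGp0).hasFDerivAt.sub_const 1).fderiv
    have h2 := DFunLike.congr_fun (h1.symm.trans h0) (p - c)
    rw [InnerProductSpace.toDual_apply_apply, hsx p hGp0, hGp] at h2
    exact one_ne_zero h2
  · ext x
    rw [Set.mem_inter_iff, ← hG1, and_comm]
    exact and_congr_right fun _ => sub_eq_zero.symm

/-- A normal of `K₀ + K₁` is a normal of `K₀`, so the normals of `K₀ + K₁` are unique if those of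
`K₀` are. -/
theorem IsOfClass.add_one {K₀ K₁ : Set E} (h₀ : IsConvexBody K₀) (h₁ : IsConvexBody K₁)
    (hc : IsClosed (K₀ + K₁)) (hC : IsOfClass 1 K₀) : IsOfClass 1 (K₀ + K₁) := by
  refine isOfClass_one_of_unique_normal (h₀.add h₁ hc) fun p u w hu hw => ?_
  obtain ⟨a, ha, b, hb, rfl⟩ := Set.mem_add.mp hu.1
  obtain ⟨f, hf⟩ := hC.exists_isBoundaryGraph one_ne_zero h₀.isClosed (hw.left_of_add ha hb)
  exact hf.normal_unique one_ne_zero h₀ (hu.left_of_add ha hb)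

end Gauge

end MinkowskiSum

theorem proposition5p1 (n : ℕ) (K₀ K₁ : Set (EuclideanSpace ℝ (Fin n)))
    (h₀ : MinkowskiSum.IsConvexBody K₀) (h₁ : MinkowskiSum.IsConvexBody K₁)
    (hclosed : IsClosed (K₀ + K₁)) :
    MinkowskiSum.IsConvexBody (K₀ + K₁) ∧
    (MinkowskiSum.IsStrictlyConvex K₀ → MinkowskiSum.IsStrictlyConvex K₁ →
      MinkowskiSum.IsStrictlyConvex (K₀ + K₁)) ∧
    (MinkowskiSum.IsOfClass 1 K₀ → MinkowskiSum.IsOfClass 1 (K₀ + K₁)) ∧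
    (∀ k : ℕ∞, 2 ≤ k → MinkowskiSum.IsOfClass k K₀ → MinkowskiSum.IsOfClass k K₁ →
      MinkowskiSum.IsPositivelyCurved K₀ → MinkowskiSum.IsOfClass k (K₀ + K₁)) ∧
    (MinkowskiSum.IsOfClass ω K₀ → MinkowskiSum.IsOfClass ω K₁ →
      MinkowskiSum.IsPositivelyCurved K₀ → MinkowskiSum.IsOfClass ω (K₀ + K₁)) ∧
    (MinkowskiSum.IsPositivelyCurved K₀ → MinkowskiSum.IsPositivelyCurved K₁ →
      MinkowskiSum.IsPositivelyCurved (K₀ + K₁)) := by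
  refine ⟨h₀.add h₁ hclosed, MinkowskiSum.IsStrictlyConvex.add h₀ h₁ hclosed,
    MinkowskiSum.IsOfClass.add_one h₀ h₁ hclosed, fun k hk => ?_,
    MinkowskiSum.IsOfClass.add (m := ω) (by simp) (by simp) h₀ h₁ hclosed,
    MinkowskiSum.IsPositivelyCurved.add h₀ h₁ hclosed⟩
  obtain ⟨m, rfl⟩ := exists_add_of_le hk
  refine MinkowskiSum.IsOfClass.add (m := ((1 + m : ℕ∞) : ℕ∞ω)) ?_ ?_ h₀ h₁ hclosed
  · simp
  · have h : 2 + m = 1 + m + 1 := by rw [← one_add_one_eq_two]; ring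
    rw [h]
    rfl
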